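/- Let $(\Omega,\mathcal A,\mathbb P)$ be a probability space, let $(\mathcal S,\mathcal B_{\mathcal S})$ be a measurable space (for instance $\mathbb R^d\times[-L,L]$ with its Borel $\sigma$-algebra), and let $X_1,X_2,\dots:\Omega\to\mathcal S$ be i.i.d. with law $Q$. Write $Q_n=\frac1n\sum_{i=1}^n\delta_{X_i}$ for the empirical measure, $\mathbb P^*(C)=\inf\{\mathbb P(\tilde C):C\subseteq\tilde C\in\mathcal A\}$ for the outer probability of $C\subseteq\Omega$, and $v_nf=\sqrt n\,(\int f\,dQ_n-\int f\,dQ)$ for $f\in L^1(Q)$. A class $\mathcal G$ of functions in $L^1(Q)$ is called $Q$-Donsker if the processes $(v_nf)_{f\in\mathcal G}$ are maps into $\ell^\infty(\mathcal G)$ that converge in distribution to a tight limit in $\ell^\infty(\mathcal G)$, that is, there is a tight Borel probability measure $\Lambda$ on $\ell^\infty(\mathcal G)$ such that the outer expectations $\mathbb E^*[h(v_n)]$ converge to $\int h\,d\Lambda$ for every bounded continuous $h:\ell^\infty(\mathcal G)\to\mathbb R$. A class of measurable sets is $Q$-Donsker if the class of its indicator functions is. For real-valued, not necessarily measurable, maps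 $M_n$ on $\Omega$ and numbers $a_n>0$, $M_n=O_{\mathbb P^*}(a_n)$ means that $M_n/a_n$ is asymptotically tight: for every $\varepsilon>0$ there is a compact $K\subset\mathbb R$ such that $\limsup_{n\to\infty}\mathbb P^*(M_n/a_n\notin K^\delta)<\varepsilon$ for every $\delta>0$, where $K^\delta=\{y:d(y,K)<\delta\}$. Let $\mathfrak B\subseteq\mathcal B_{\mathcal S}$, let $\mathcal F$ be a uniformly bounded set of functions $\mathcal S\to\mathbb R$ in $L^1(Q)$, and let $\mathcal F_{\mathfrak B}=\{f\mathbf 1_A: f\in\mathcal F,\ A\in\mathfrak B\}$. If $\mathfrak B$ and $\mathcal F_{\mathfrak B}$ are $Q$-Donsker, then for every $\alpha\in[0,1/2)$, with $\mathfrak B_n=\{A\in\mathfrak B: Q_n(A)\ge n^{-\alpha}\}$, $$\sup_{f\in\mathcal F}\ \sup_{A\in\mathfrak B_n}\bigl|\mathbb E_n[f\mid A]-\mathbb E[f\mid A]\bigr| = O_{\mathbb P^*}(n^{\alpha-1/2}),$$ where $\mathbb E_n[f\mid A]=\sum_{i=1}^n f(X_i)\mathbf 1_A(X_i)\big/\sum_{i=1}^n\mathbf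 1_A(X_i)$ and $\mathbb E[f\mid A]=\int_A f\,dQ/Q(A)$ (with value $0$ if $Q(A)=0$), and a supremum over the empty set is $0$. -/

import Mathlib

open MeasureTheory ProbabilityTheory Filter Topology
open scoped lp ENNReal BoundedContinuousFunction

noncomputable section

namespace EmpiricalProcess

variable {Ω S : Type*}

/-! ### Outer expectation, asymptotic tightness, convergence in distribution

The outer probability of an arbitrary set `A`, that is, the infimum of the probabilities of the
measurable sets containing `A`, is `P A` for a Mathlib measure `P`. -/

/-- Outer expectation of a bounded, not necessarily measurable, function `T`: the infimum of `E[U]`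
over measurable integrable `U ≥ T`. -/
def outerExpectation [MeasurableSpace Ω] (P : Measure Ω) (T : Ω → ℝ) : ℝ :=
  sInf {r | ∃ U : Ω → ℝ, Measurable U ∧ Integrable U P ∧ (∀ ω, T ω ≤ U ω) ∧ r = ∫ ω, U ω ∂P}

/-- A sequence of (not necessarily measurable) maps `Y n : Ω → D` converges in distribution, in the
sense of outer expectations, to a tight Borel probability measure on `D`. -/
def ConvergesToTightLimit [MeasurableSpace Ω] (P : Measure Ω) {D : Type*} [MetricSpace D]
    (Y : ℕ → Ω → D) : Prop :=
  letI : MeasurableSpace D := borel D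
  ∃ L : Measure D, IsProbabilityMeasure L ∧
    (∀ ε : ℝ≥0∞, 0 < ε → ∃ K : Set D, IsCompact K ∧ L Kᶜ ≤ ε) ∧
    ∀ h : D →ᵇ ℝ,
      Tendsto (fun n => outerExpectation P (fun ω => h (Y n ω))) atTop (𝓝 (∫ y, h y ∂L))

/-- A sequence of (not necessarily measurable) maps `M n : Ω → D` is asymptotically tight. -/
def AsymptoticallyTight [MeasurableSpace Ω] (P : Measure Ω) {D : Type*} [MetricSpace D]
    (M : ℕ → Ω → D) : Prop :=
  ∀ ε : ℝ, 0 < ε → ∃ K : Set D, IsCompact K ∧ ∀ δ : ℝ, 0 < δ →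
    limsup (fun n => P {ω | M n ω ∉ Metric.thickening δ K}) atTop < ENNReal.ofReal ε

/-- `M n = O_{P*}(a n)`: the sequence `M n / a n` is asymptotically tight. -/
def IsBigOOuterProb [MeasurableSpace Ω] (P : Measure Ω) (M : ℕ → Ω → ℝ) (a : ℕ → ℝ) : Prop :=
  AsymptoticallyTight P (fun n ω => M n ω / a n)

/-! ### Empirical quantities for the sample `X 0 ω, …, X (n - 1) ω` -/

/-- `∫ f dQ_n`, the mean of `f` under the empirical measure of the first `n` observations. -/
def empMean (X : ℕ → Ω → S) (n : ℕ) (f : S → ℝ) (ω : Ω) : ℝ :=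
  (∑ i ∈ Finset.range n, f (X i ω)) / n

/-- `Q_n(A)`, the empirical measure of `A`. -/
def empProb (X : ℕ → Ω → S) (n : ℕ) (A : Set S) (ω : Ω) : ℝ :=
  empMean X n (A.indicator 1) ω

/-- `v_n f = √n (∫ f dQ_n - ∫ f dQ)`, the empirical process. -/
def empProcess [MeasurableSpace S] (Q : Measure S) (X : ℕ → Ω → S) (n : ℕ) (f : S → ℝ) (ω : Ω) :
    ℝ :=
  √(n : ℝ) * (empMean X n f ω - ∫ x, f x ∂Q)

/-- `E_n[f | A] = ∑ f(X_i) 1_A(X_i) / ∑ 1_A(X_i)`, to be used when `Q_n(A) > 0`. -/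
def empCondExp (X : ℕ → Ω → S) (n : ℕ) (f : S → ℝ) (A : Set S) (ω : Ω) : ℝ :=
  (∑ i ∈ Finset.range n, A.indicator f (X i ω)) /
    ∑ i ∈ Finset.range n, A.indicator (1 : S → ℝ) (X i ω)

/-- `E[f | A] = E[f 1_A] / Q(A)`, with the value `0` when `Q(A) = 0`. -/
def setCondExp [MeasurableSpace S] (Q : Measure S) (f : S → ℝ) (A : Set S) : ℝ :=
  (∫ x, A.indicator f x ∂Q) / Q.real A

/-! ### Donsker classes -/

/-- A class `F` of functions in `L¹(Q)` is `Q`-Donsker (for the sample `X`): the empirical processes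
`(v_n f)_{f ∈ F}` are maps into `ℓ^∞(F)` that converge in distribution to a tight limit there. -/
def IsDonsker [MeasurableSpace Ω] [MeasurableSpace S] (P : Measure Ω) (Q : Measure S)
    (X : ℕ → Ω → S) (F : Set (S → ℝ)) : Prop :=
  (∀ f ∈ F, Integrable f Q) ∧
    ∃ Y : ℕ → Ω → ℓ^∞(F, ℝ),
      (∀ n ω (f : F), Y n ω f = empProcess Q X n f ω) ∧ ConvergesToTightLimit P Y

/-- A class of measurable sets is `Q`-Donsker if the class of its indicator functions is. -/
def IsDonskerSets [MeasurableSpace Ω] [MeasurableSpace S] (P : Measure Ω) (Q : Measure S)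
    (X : ℕ → Ω → S) (B : Set (Set S)) : Prop :=
  IsDonsker P Q X {g | ∃ A ∈ B, g = A.indicator (1 : S → ℝ)}

/-! ### The quantities compared -/

/-- `{f 1_A : f ∈ F, A ∈ B}`. -/
def restrictedClass (F : Set (S → ℝ)) (B : Set (Set S)) : Set (S → ℝ) :=
  {g | ∃ f ∈ F, ∃ A ∈ B, g = A.indicator f}

/-- The random class `B_n` of those `A ∈ B` with `Q_n(A) ≥ n ^ (-α)`. -/
def heavySets (X : ℕ → Ω → S) (B : Set (Set S)) (α : ℝ) (n : ℕ) (ω : Ω) : Set (Set S) :=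
  {A | A ∈ B ∧ (n : ℝ) ^ (-α) ≤ empProb X n A ω}

/-- `sup_{f ∈ F} sup_{A ∈ B_n} |E_n[f | A] - E[f | A]|`; the supremum over an empty family is `0`.
For uniformly bounded `F` the set of values is bounded. -/
def condExpDeviation [MeasurableSpace S] (Q : Measure S) (X : ℕ → Ω → S) (F : Set (S → ℝ))
    (B : Set (Set S)) (α : ℝ) (n : ℕ) (ω : Ω) : ℝ :=
  sSup {r | ∃ f ∈ F, ∃ A ∈ heavySets X B α n ω, r = |empCondExp X n f A ω - setCondExp Q f A|}

end EmpiricalProcess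

end

namespace EmpiricalProcess

variable {Ω S : Type*}

section OuterProbability

variable [MeasurableSpace Ω]

/-! Since `E[f | A] Q(A) = E[f 1_A]`, the error `E_n[f | A] - E[f | A]` equals `((Q_n - Q)(f 1_A) -
E[f | A] (Q_n - Q)(A)) / Q_n(A)`. Convergence to a tight limit bounds both empirical processes in
outer probability, so the numerator is of order `n ^ (-1/2)` uniformly in `f` and `A`; dividing by
`Q_n(A) ≥ n ^ (-α)` costs at most a factor `n ^ α`. The bound is deterministic off two events of
small outer probability (`abs_empCondExp_sub_setCondExp_le`), so no measurability of the suprema is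
needed. -/

/-- Markov's inequality for the outer expectation. -/
theorem measure_one_le_le_outerExpectation (P : Measure Ω) [IsFiniteMeasure P] {T : Ω → ℝ}
    (hT0 : ∀ ω, 0 ≤ T ω) {C : ℝ} (hTC : ∀ ω, T ω ≤ C) :
    P {ω | 1 ≤ T ω} ≤ ENNReal.ofReal (outerExpectation P T) := by
  rw [← ENNReal.ofReal_toReal (measure_ne_top P _)]
  -- The constant majorant `C` shows that the infimum is over a nonempty set.
  refine ENNReal.ofReal_le_ofReal (le_csInf ⟨_, fun _ => C, measurable_const,
    integrable_const C, hTC, rfl⟩ ?_)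
  rintro r ⟨U, -, hUi, hTU, rfl⟩
  have hmarkov := mul_meas_ge_le_integral_of_nonneg
    (ae_of_all P fun ω => (hT0 ω).trans (hTU ω)) hUi 1
  rw [one_mul] at hmarkov
  have hsub : {ω | 1 ≤ T ω} ⊆ {ω | 1 ≤ U ω} := fun ω (hω : 1 ≤ T ω) => hω.trans (hTU ω)
  exact (measureReal_mono hsub).trans hmarkov

/-- The truncation `y ↦ min (max (‖y‖ - M) 0) 1` of the norm, as a bounded continuous function. -/
def normExcess (D : Type*) [NormedAddCommGroup D] (M : ℝ) : D →ᵇ ℝ :=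
  BoundedContinuousFunction.ofNormedAddCommGroup (fun y => min (max (‖y‖ - M) 0) 1)
    (by fun_prop) 1 fun y => by
      rw [Real.norm_of_nonneg (le_min (le_max_right _ _) zero_le_one)]
      exact min_le_right _ _

theorem normExcess_apply {D : Type*} [NormedAddCommGroup D] (M : ℝ) (y : D) :
    normExcess D M y = min (max (‖y‖ - M) 0) 1 := rfl

/-- Maps converging in distribution to a tight limit are bounded in outer probability. -/
theorem ConvergesToTightLimit.eventually_measure_lt_norm_le {P : Measure Ω} [IsFiniteMeasure P]
    {D : Type*} [NormedAddCommGroup D] {Y : ℕ → Ω → D} (hY : ConvergesToTightLimit P Y)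
    {ε : ℝ} (hε : 0 < ε) :
    ∃ M : ℝ, 0 ≤ M ∧ ∀ᶠ n in atTop, P {ω | M < ‖Y n ω‖} ≤ ENNReal.ofReal ε := by
  let _ : MeasurableSpace D := borel D
  have : BorelSpace D := ⟨rfl⟩
  obtain ⟨L, hL, htight, hconv⟩ := hY
  obtain ⟨K, hK, hLK⟩ := htight (ENNReal.ofReal (ε / 2)) (by simpa using hε)
  obtain ⟨M, hM0, hKM⟩ := hK.isBounded.exists_pos_norm_le
  -- The truncation vanishes on `K` and is at most `1` elsewhere.
  have hint : ∫ y, normExcess D M y ∂L ≤ ε / 2 := by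
    calc ∫ y, normExcess D M y ∂L
        ≤ ∫ y, Kᶜ.indicator (1 : D → ℝ) y ∂L := by
          refine integral_mono ((normExcess D M).integrable L)
            ((integrable_const (1 : ℝ)).indicator hK.measurableSet.compl) fun y => ?_
          by_cases hy : y ∈ K
          · simp [normExcess_apply, hy, hKM y hy]
          · simp [normExcess_apply, hy]
      _ = L.real Kᶜ := integral_indicator_one hK.measurableSet.compl
      _ ≤ ε / 2 := ENNReal.toReal_le_of_le_ofReal (by positivity) hLK
  -- Beyond radius `M + 1` the truncation equals `1`, so Markov applies.
  refine ⟨M + 1, by positivity, ?_⟩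
  filter_upwards [(hconv (normExcess D M)).eventually_lt_const
    (show ∫ y, normExcess D M y ∂L < ε by linarith)] with n hn
  refine le_trans (measure_mono fun ω hω => ?_)
    ((measure_one_le_le_outerExpectation P (T := fun ω => normExcess D M (Y n ω))
      (fun ω => le_min (le_max_right _ _) zero_le_one) (fun ω => min_le_right _ _)).trans
      (ENNReal.ofReal_le_ofReal hn.le))
  have hω' : M + 1 < ‖Y n ω‖ := hω
  exact le_min (le_max_of_le_left (le_sub_iff_add_le'.2 hω'.le)) le_rfl

end OuterProbability

/-- The empirical process over a Donsker class is bounded in outer probability. -/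
theorem IsDonsker.eventually_measure_exists_lt_abs_le [MeasurableSpace Ω] [MeasurableSpace S]
    {P : Measure Ω} [IsFiniteMeasure P]
    {Q : Measure S} {X : ℕ → Ω → S} {G : Set (S → ℝ)} (hG : IsDonsker P Q X G)
    {ε : ℝ} (hε : 0 < ε) :
    ∃ M : ℝ, 0 ≤ M ∧ ∀ᶠ n in atTop,
      P {ω | ∃ f ∈ G, M < |(empProcess Q X n f ω)|} ≤ ENNReal.ofReal ε := by
  obtain ⟨-, Y, hY, hconv⟩ := hG
  obtain ⟨M, hM0, hM⟩ := hconv.eventually_measure_lt_norm_le hε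
  refine ⟨M, hM0, hM.mono fun n hn => (measure_mono ?_).trans hn⟩
  rintro ω ⟨f, hf, hlt⟩
  rw [← hY n ω ⟨f, hf⟩] at hlt
  exact hlt.trans_le (lp.norm_apply_le_norm ENNReal.top_ne_zero (Y n ω) ⟨f, hf⟩)

theorem abs_empMean_sub_integral_le [MeasurableSpace S] {Q : Measure S} {X : ℕ → Ω → S} {n : ℕ}
    (hn : 0 < n) {f : S → ℝ} {ω : Ω} {M : ℝ} (h : |(empProcess Q X n f ω)| ≤ M) :
    |empMean X n f ω - ∫ x, f x ∂Q| ≤ M * (n : ℝ) ^ (-(1 / 2) : ℝ) := by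
  have hs : 0 < √(n : ℝ) := Real.sqrt_pos.2 (Nat.cast_pos.2 hn)
  rw [empProcess, abs_mul, abs_of_pos hs, mul_comm] at h
  rw [Real.rpow_neg (Nat.cast_nonneg n), ← Real.sqrt_eq_rpow, ← div_eq_mul_inv]
  exact (le_div_iff₀ hs).2 h

theorem empCondExp_eq_div (X : ℕ → Ω → S) {n : ℕ} (hn : 0 < n) (f : S → ℝ) (A : Set S) (ω : Ω) :
    empCondExp X n f A ω = empMean X n (A.indicator f) ω / empProb X n A ω :=
  (div_div_div_cancel_right₀ (Nat.cast_ne_zero.2 hn.ne') _ _).symm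

theorem abs_setCondExp_le [MeasurableSpace S] {Q : Measure S} [IsFiniteMeasure Q] {f : S → ℝ} {A : Set S}
    (hA : MeasurableSet A) {c : ℝ} (hc : 0 ≤ c) (hf : ∀ x, |f x| ≤ c) :
    |setCondExp Q f A| ≤ c := by
  rw [setCondExp, abs_div, abs_of_nonneg measureReal_nonneg, integral_indicator hA]
  exact div_le_of_le_mul₀ measureReal_nonneg hc
    (norm_setIntegral_le_of_norm_le_const (f := f) (measure_lt_top Q A) fun x _ => hf x)

/-- If `Q(A) = 0`, both sides vanish. Hence no lower bound on `Q(A)` is ever required. -/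
theorem setCondExp_mul_measureReal [MeasurableSpace S] {Q : Measure S} [IsFiniteMeasure Q] (f : S → ℝ)
    {A : Set S} (hA : MeasurableSet A) : setCondExp Q f A * Q.real A = ∫ x, A.indicator f x ∂Q := by
  by_cases h : Q.real A = 0
  · rw [h, mul_zero, integral_indicator hA,
      setIntegral_measure_zero f ((measureReal_eq_zero_iff (measure_ne_top Q A)).1 h)]
  · exact div_mul_cancel₀ _ h

/-- The deviation of the empirical conditional expectation from the true one on a set of large
empirical measure, in terms of the empirical process. -/
theorem abs_empCondExp_sub_setCondExp_le [MeasurableSpace S] {Q : Measure S} [IsFiniteMeasure Q]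
    {X : ℕ → Ω → S} {n : ℕ} (hn : 0 < n) {f : S → ℝ} {A : Set S} (hA : MeasurableSet A)
    {ω : Ω} {c M N α : ℝ} (hc : 0 ≤ c) (hf : ∀ x, |f x| ≤ c) (hM : |(empProcess Q X n (A.indicator f) ω)| ≤ M)
    (hN : |(empProcess Q X n (A.indicator 1) ω)| ≤ N) (hα : (n : ℝ) ^ (-α) ≤ empProb X n A ω) :
    |empCondExp X n f A ω - setCondExp Q f A| ≤ (M + c * N) * (n : ℝ) ^ (α - 1 / 2) := by
  have hn' : (0 : ℝ) < n := Nat.cast_pos.2 hn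
  have hpow : 0 < (n : ℝ) ^ (-α) := Real.rpow_pos_of_pos hn' _
  have hq : 0 < empProb X n A ω := hpow.trans_le hα
  have hM0 : 0 ≤ M := (abs_nonneg _).trans hM
  have hN0 : 0 ≤ N := (abs_nonneg _).trans hN
  have h1 := abs_empMean_sub_integral_le hn hM
  have h2 := abs_empMean_sub_integral_le hn hN
  rw [integral_indicator_one hA] at h2
  change |empProb X n A ω - Q.real A| ≤ _ at h2
  have hdecomp : empCondExp X n f A ω - setCondExp Q f A =
      ((empMean X n (A.indicator f) ω - ∫ x, A.indicator f x ∂Q) -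
        setCondExp Q f A * (empProb X n A ω - Q.real A)) / empProb X n A ω := by
    rw [empCondExp_eq_div X hn, mul_sub, setCondExp_mul_measureReal f hA]
    field_simp
    ring
  have hsplit : (n : ℝ) ^ (α - 1 / 2) * (n : ℝ) ^ (-α) = (n : ℝ) ^ (-(1 / 2) : ℝ) := by
    rw [← Real.rpow_add hn']
    ring_nf
  rw [hdecomp, abs_div, abs_of_pos hq, div_le_iff₀ hq]
  calc _ ≤ |empMean X n (A.indicator f) ω - ∫ x, A.indicator f x ∂Q| +
        |setCondExp Q f A| * |empProb X n A ω - Q.real A| := by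
        rw [← abs_mul]
        exact abs_sub _ _
    _ ≤ M * (n : ℝ) ^ (-(1 / 2) : ℝ) + c * (N * (n : ℝ) ^ (-(1 / 2) : ℝ)) :=
        add_le_add h1 (mul_le_mul (abs_setCondExp_le hA hc hf) h2 (abs_nonneg _) hc)
    _ = (M + c * N) * (n : ℝ) ^ (α - 1 / 2) * (n : ℝ) ^ (-α) := by
        rw [mul_assoc _ ((n : ℝ) ^ (α - 1 / 2)), hsplit]
        ring
    _ ≤ _ := mul_le_mul_of_nonneg_left hα (by positivity)

theorem condExpDeviation_nonneg [MeasurableSpace S] (Q : Measure S) (X : ℕ → Ω → S) (F : Set (S → ℝ))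
    (B : Set (Set S)) (α : ℝ) (n : ℕ) (ω : Ω) : 0 ≤ condExpDeviation Q X F B α n ω := by
  refine Real.sSup_nonneg ?_
  rintro r ⟨f, -, A, -, rfl⟩
  exact abs_nonneg _

end EmpiricalProcess

open EmpiricalProcess in
theorem proposition4 {Ω S : Type*} [MeasurableSpace Ω] [MeasurableSpace S]
    (P : Measure Ω) [IsProbabilityMeasure P] (Q : Measure S)
    (X : ℕ → Ω → S) (hX : ∀ i, Measurable (X i)) (hXind : iIndepFun X P)
    (hXlaw : ∀ i, P.map (X i) = Q)
    (B : Set (Set S)) (hB : ∀ A ∈ B, MeasurableSet A)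
    (F : Set (S → ℝ)) (hF : ∀ f ∈ F, Integrable f Q)
    (hFbdd : ∃ c : ℝ, ∀ f ∈ F, ∀ x, |f x| ≤ c)
    (hBDonsker : IsDonskerSets P Q X B)
    (hFBDonsker : IsDonsker P Q X (restrictedClass F B))
    (α : ℝ) (hα0 : 0 ≤ α) (hα : α < 1 / 2) :
    IsBigOOuterProb P (condExpDeviation Q X F B α) (fun n => (n : ℝ) ^ (α - 1 / 2)) := by
  intro ε hε
  have : IsFiniteMeasure Q := by
    rw [← hXlaw 0]
    infer_instance
  obtain ⟨c, hc⟩ := hFbdd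
  obtain ⟨M, hM0, hM⟩ :=
    hFBDonsker.eventually_measure_exists_lt_abs_le (show 0 < ε / 4 by positivity)
  obtain ⟨N, hN0, hN⟩ :=
    IsDonsker.eventually_measure_exists_lt_abs_le hBDonsker (show 0 < ε / 4 by positivity)
  -- `|c|` is used because `c` may be negative when `F` is empty.
  refine ⟨Set.Icc 0 (M + |c| * N), isCompact_Icc, fun δ hδ => ?_⟩
  -- Two exceptional events of size `ε / 4` leave room for the strict inequality.
  refine lt_of_le_of_lt (b := ENNReal.ofReal (ε / 2)) (limsup_le_of_le (h := ?_))
    ((ENNReal.ofReal_lt_ofReal_iff hε).2 (by linarith))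
  filter_upwards [hM, hN, eventually_gt_atTop 0] with n hMn hNn hn
  have hsum : ENNReal.ofReal (ε / 2) = ENNReal.ofReal (ε / 4) + ENNReal.ofReal (ε / 4) := by
    rw [← ENNReal.ofReal_add (by positivity) (by positivity)]
    ring_nf
  rw [hsum]
  refine (measure_mono fun ω hω => ?_).trans ((measure_union_le _ _).trans (add_le_add hMn hNn))
  by_contra hcon
  simp only [Set.mem_union, Set.mem_ofPred_eq, not_or, not_exists, not_and, not_lt] at hcon
  have ha : 0 < (n : ℝ) ^ (α - 1 / 2) := Real.rpow_pos_of_pos (Nat.cast_pos.2 hn) _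
  refine hω (Metric.self_subset_thickening hδ _
    ⟨div_nonneg (condExpDeviation_nonneg Q X F B α n ω) ha.le, (div_le_iff₀ ha).2 ?_⟩)
  -- Nonnegativity of the bound covers the empty supremum.
  refine Real.sSup_le ?_ (by positivity)
  rintro r ⟨f, hf, A, ⟨hAB, hAα⟩, rfl⟩
  exact abs_empCondExp_sub_setCondExp_le hn (hB A hAB) (abs_nonneg c)
    (fun x => (hc f hf x).trans (le_abs_self c)) (hcon.1 _ ⟨f, hf, A, hAB, rfl⟩)
    (hcon.2 _ ⟨A, hAB, rfl⟩) hAα
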